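/- Let $n \ge 4$ and let $\mathbb{F}_{2^n}$ be the field with $2^n$ elements. For $c \in \mathbb{F}_{2^n}$ let $\mathrm{Tr}(c) = \sum_{i=0}^{n-1} c^{2^i} \in \mathbb{F}_2$ be the absolute trace, let $$Q(c) = \sum_{0 \le i < j < n} c^{2^i+2^j}$$ be the quadratic trace, and let $$\mathcal{K}(c) = \sum_{x \in \mathbb{F}_{2^n}} (-1)^{\mathrm{Tr}(x^{2^n-2} + c x)} \in \mathbb{Z}$$ be the binary Kloosterman sum. Then for every $a \in \mathbb{F}_{2^n}$ we have $Q(a) \in \mathbb{F}_2 = \{0,1\}$ and $$\mathcal{K}(a) \equiv \begin{cases} 0 \pmod{16} & \text{if } \mathrm{Tr}(a) = 0 \text{ and } Q(a) = 0,\\ 4 \pmod{16} & \text{if } \mathrm{Tr}(a) = 1 \text{ and } Q(a) = 1,\\ 8 \pmod{16} & \text{if } \mathrm{Tr}(a) = 0 \text{ and } Q(a) = 1,\\ 12 \pmod{16} & \text{if } \mathrm{Tr}(a) = 1 \text{ and } Q(a) = 0. \end{cases}$$ -/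

import Mathlib

open Finset

/-- The binary Kloosterman sum `K(a) = ∑ x, ζ ^ Tr (x ^ (q - 2) + a * x)` over a finite field `F`
with `q = 2 ^ n` elements. Here `Tr` is the absolute trace from `F` to the field with two elements,
and `ζ = -1` is the primitive square root of unity, so the sum is an integer. -/
noncomputable def binaryKloosterman (F : Type*) [Field F] [Fintype F] [Algebra (ZMod 2) F] (a : F) : ℤ :=
  ∑ x : F, (-1 : ℤ) ^ (Algebra.trace (ZMod 2) F (x ^ (Fintype.card F - 2) + a * x)).val

/-- The quadratic trace `Q(a) = ∑ a ^ (2 ^ i + 2 ^ j)`, over all pairs `0 ≤ i < j < n`,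
as an element of the field `F` with `2 ^ n` elements. -/
def quadraticTrace {F : Type*} [Field F] (n : ℕ) (a : F) : F :=
  ∑ j ∈ range n, ∑ i ∈ range j, a ^ (2 ^ i + 2 ^ j)

/-!
The proof takes place in the ring of Witt vectors `W = W(F)`, with Teichmüller map `T : F → W`. For
`y : F` put `τ(y) = ∑ T(y) ^ (2 ^ i)`, summed over `0 ≤ i < n`. This element is fixed by Frobenius,
hence is a `2`-adic integer, and it lifts `Tr y` (`exists_nat_of_frobenius_eq`). Although `T` is not
additive, `t(x) = τ(x⁻¹) + τ(a x)` therefore has the parity of `Tr (x⁻¹ + a x)`, and expanding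
`(1 - 2) ^ t` binomially gives `3 (-1) ^ t ≡ 3 - 20 t + 18 t ^ 2 - 4 t ^ 3` modulo `16`.

Summing over `x`, orthogonality of the Teichmüller powers (`sum_teichmuller_inv_pow_mul_pow`) kills
every monomial `T(x⁻¹) ^ r * T(a x) ^ s` with `r ≢ s` modulo `2 ^ n - 1`. Sums of at most three
powers of two are short enough that, for `n ≥ 4`, the identity `τ² = τ + 2 Q` (`conjSum_sq`) reduces
all moments to the single surviving one, `∑ τ(x⁻¹) τ(a x) = (2 ^ n - 1) τ(a)`. The outcome
(`sum_cubic_conjSum`, `dvd_binaryKloosterman_add`) is `K(a) ≡ -4 τ(a)` modulo `16`.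

So `K(a)` modulo `16` depends on `τ(a)` modulo `4`. Its parity is `Tr a`, and by `τ² = τ + 2 Q` the
quadratic trace is the reduction of the binomial coefficient of `τ(a)` over `2`
(`quadraticTrace_eq_choose_two`), whose parity is the second binary digit of `τ(a)`.
-/

open WittVector

/-! ### Sums over conjugates -/

/-- The sum `∑ x ^ (2 ^ i)` over `0 ≤ i < n`: over a field with `2 ^ n` elements it is the absolute
trace, and at a Teichmüller representative it is a `2`-adic lift of that trace. -/
def conjSum {R : Type*} [CommRing R] (n : ℕ) (x : R) : R :=
  ∑ i ∈ range n, x ^ 2 ^ i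

/-- The sum `∑ x ^ (2 ^ i + 2 ^ j)` over `0 ≤ i < j < n` in a commutative ring; over a field it is
`quadraticTrace`. -/
def conjPairSum {R : Type*} [CommRing R] (n : ℕ) (x : R) : R :=
  ∑ j ∈ range n, ∑ i ∈ range j, x ^ (2 ^ i + 2 ^ j)

lemma map_conjSum {R S : Type*} [CommRing R] [CommRing S] (f : R →+* S) (n : ℕ) (x : R) :
    f (conjSum n x) = conjSum n (f x) := by
  simp [conjSum, map_sum]

lemma map_conjPairSum {R S : Type*} [CommRing R] [CommRing S] (f : R →+* S) (n : ℕ) (x : R) :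
    f (conjPairSum n x) = conjPairSum n (f x) := by
  simp [conjPairSum, map_sum]

lemma conjSum_pow_two {R : Type*} [CommRing R] {n : ℕ} {x : R} (hx : x ^ 2 ^ n = x) :
    conjSum n (x ^ 2) = conjSum n x := by
  have h := sum_range_succ' (fun i => x ^ 2 ^ i) n
  rw [sum_range_succ, hx, pow_zero, pow_one] at h
  simp only [conjSum, ← pow_mul, ← pow_succ']
  exact (add_right_cancel h).symm

lemma conjSum_sq_eq {R : Type*} [CommRing R] (n : ℕ) (x : R) :
    conjSum n x ^ 2 = conjSum n (x ^ 2) + 2 * conjPairSum n x := by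
  induction n with
  | zero => simp [conjSum, conjPairSum]
  | succ n ih =>
    have h : ∑ i ∈ range n, x ^ (2 ^ i + 2 ^ n) = conjSum n x * x ^ 2 ^ n := by
      simp only [conjSum, sum_mul, pow_add]
    simp only [conjSum, conjPairSum, sum_range_succ] at ih h ⊢
    rw [h, add_sq, ih]
    ring

/-- The square of the lifted trace: squaring permutes the conjugates of `x`, so only the cross terms
remain. -/
lemma conjSum_sq {R : Type*} [CommRing R] {n : ℕ} {x : R} (hx : x ^ 2 ^ n = x) :
    conjSum n x ^ 2 = conjSum n x + 2 * conjPairSum n x := by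
  rw [conjSum_sq_eq, conjSum_pow_two hx]

/-! ### Sums of powers of two modulo `2 ^ n - 1` -/

lemma not_dvd_of_lt_of_ne {q m : ℕ} (h0 : 0 < m) (h1 : m < 2 * q) (h2 : m ≠ q) : ¬ q ∣ m := by
  rintro ⟨k, rfl⟩
  rcases k with _ | _ | k
  · simp at h0
  · simp at h2
  · nlinarith [Nat.zero_le (q * k)]

lemma two_pow_mod_sixteen (i : ℕ) :
    2 ^ i % 16 = 1 ∨ 2 ^ i % 16 = 2 ∨ 2 ^ i % 16 = 4 ∨ 2 ^ i % 16 = 8 ∨ 2 ^ i % 16 = 0 := by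
  induction i with
  | zero => simp
  | succ i ih => rw [pow_succ]; omega

lemma two_pow_mod_sixteen_eq_zero {n : ℕ} (hn : 4 ≤ n) : 2 ^ n % 16 = 0 :=
  Nat.mod_eq_zero_of_dvd (pow_dvd_pow 2 hn)

lemma two_mul_two_pow_le {i n : ℕ} (hi : i < n) : 2 * 2 ^ i ≤ 2 ^ n := by
  rw [← pow_succ']
  exact Nat.pow_le_pow_right (by norm_num) hi

lemma not_dvd_two_pow {n i : ℕ} (hn : 4 ≤ n) (hi : i < n) : ¬ 2 ^ n - 1 ∣ 2 ^ i := by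
  have h0 := Nat.two_pow_pos i
  have := two_mul_two_pow_le hi
  have := two_pow_mod_sixteen i
  have := two_pow_mod_sixteen_eq_zero hn
  apply not_dvd_of_lt_of_ne <;> omega

lemma not_dvd_two_pow_add {n i j : ℕ} (hn : 4 ≤ n) (hi : i < n) (hj : j < n) :
    ¬ 2 ^ n - 1 ∣ 2 ^ i + 2 ^ j := by
  have h0 := Nat.two_pow_pos i
  have := two_mul_two_pow_le hi
  have := two_mul_two_pow_le hj
  have := two_pow_mod_sixteen i
  have := two_pow_mod_sixteen j
  have := two_pow_mod_sixteen_eq_zero hn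
  apply not_dvd_of_lt_of_ne <;> omega

/-- The sum lies below `2 * (2 ^ n - 1)`, and it differs from `2 ^ n - 1 ≡ 15` modulo `16` because
three powers of two cannot add up to `15` there. -/
lemma not_dvd_two_pow_add_add {n i j k : ℕ} (hn : 4 ≤ n)
    (hi : i < n) (hj : j < n) (hk : k < n) :
    ¬ 2 ^ n - 1 ∣ 2 ^ i + 2 ^ j + 2 ^ k := by
  have h0 := Nat.two_pow_pos i
  have := two_mul_two_pow_le hi
  have := two_mul_two_pow_le hj
  have := two_mul_two_pow_le hk
  have := two_pow_mod_sixteen i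
  have := two_pow_mod_sixteen j
  have := two_pow_mod_sixteen k
  have := two_pow_mod_sixteen_eq_zero hn
  apply not_dvd_of_lt_of_ne <;> omega

lemma two_pow_modEq_iff {n i j : ℕ} (hn : 4 ≤ n) (hi : i < n) (hj : j < n) :
    2 ^ i ≡ 2 ^ j [MOD 2 ^ n - 1] ↔ i = j := by
  refine ⟨fun h => ?_, fun h => h ▸ rfl⟩
  have := two_mul_two_pow_le hi
  have := two_mul_two_pow_le hj
  have := Nat.pow_le_pow_right (n := 2) (by norm_num) hn
  exact Nat.pow_right_injective le_rfl (h.eq_of_lt_of_lt (by omega) (by omega))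

lemma two_pow_add_not_modEq {n i j k : ℕ} (hn : 4 ≤ n) (hij : i < j) (hj : j < n) (hk : k < n) :
    ¬ 2 ^ i + 2 ^ j ≡ 2 ^ k [MOD 2 ^ n - 1] := by
  intro h
  have h1 := two_mul_two_pow_le hij
  have h2 := two_mul_two_pow_le hj
  have h3 := two_mul_two_pow_le hk
  have h4 := Nat.pow_le_pow_right (n := 2) (by norm_num) hn
  have h5 := h.eq_of_lt_of_lt (by omega) (by omega)
  have h6 := Nat.two_pow_pos i
  rcases lt_or_ge j k with hjk | hjk
  · have := two_mul_two_pow_le hjk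
    omega
  · have := Nat.pow_le_pow_right (n := 2) (by norm_num) hjk
    omega

/-! ### Teichmüller representatives and `2`-adic integers -/

lemma teichmuller_two_injective {F : Type*} [Field F] :
    Function.Injective (teichmuller 2 : F →* WittVector 2 F) := by
  intro x y h
  simpa using congrArg (fun w => w.coeff 0) h

/-- Orthogonality of the Teichmüller powers: scaling `x` by a generator of `Fˣ` multiplies the sum
by a nontrivial root of unity. -/
lemma sum_teichmuller_inv_pow_mul_pow {F : Type*} [Field F] [Fintype F] [CharP F 2]
    (a : F) {r s : ℕ}
    (h : ¬ r ≡ s [MOD Fintype.card F - 1]) :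
    ∑ x : F, teichmuller 2 x⁻¹ ^ r * teichmuller 2 (a * x) ^ s = 0 := by
  classical
  obtain ⟨g, hg⟩ := IsCyclic.exists_generator (α := Fˣ)
  have hord : orderOf g = Fintype.card F - 1 := by
    rw [orderOf_eq_card_of_forall_mem_zpowers hg, Nat.card_eq_fintype_card, Fintype.card_units]
  have hne : teichmuller 2 (g : F) ^ r ≠ teichmuller 2 (g : F) ^ s := by
    rw [← map_pow, ← map_pow]
    intro he
    have he' := teichmuller_two_injective he
    rw [← Units.val_pow_eq_pow_val, ← Units.val_pow_eq_pow_val, Units.val_inj,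
      pow_eq_pow_iff_modEq, hord] at he'
    exact h he'
  set S := ∑ x : F, teichmuller 2 x⁻¹ ^ r * teichmuller 2 (a * x) ^ s with hS
  have hsub : teichmuller 2 (g : F) ^ r * S = teichmuller 2 (g : F) ^ s * S := by
    conv_lhs => rw [hS, ← Equiv.sum_comp (Equiv.mulLeft₀ (g : F) g.ne_zero), mul_sum]
    rw [hS, mul_sum]
    refine sum_congr rfl fun x _ => ?_
    have hg1 : teichmuller 2 (g : F) ^ r * teichmuller 2 (g : F)⁻¹ ^ r = 1 := by
      rw [← mul_pow, ← map_mul, mul_inv_cancel₀ g.ne_zero, map_one, one_pow]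
    simp only [Equiv.mulLeft₀_apply, mul_inv, map_mul, mul_pow]
    linear_combination (teichmuller 2 x⁻¹ ^ r * teichmuller 2 a ^ s * teichmuller 2 (g : F) ^ s *
      teichmuller 2 x ^ s) * hg1
  by_contra hS0
  exact hne (mul_right_cancel₀ hS0 hsub)

lemma sum_teichmuller_inv_pow_mul_pow_self {F : Type*} [Field F] [Fintype F]
    (a : F) {r : ℕ} (hr : r ≠ 0) :
    ∑ x : F, teichmuller 2 x⁻¹ ^ r * teichmuller 2 (a * x) ^ r =
      ((Fintype.card F : WittVector 2 F) - 1) * teichmuller 2 a ^ r := by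
  classical
  have h (x : F) : teichmuller 2 x⁻¹ ^ r * teichmuller 2 (a * x) ^ r =
      if x ≠ 0 then teichmuller 2 a ^ r else 0 := by
    rw [← mul_pow, ← map_mul]
    split_ifs with hx
    · congr 2
      field_simp
    · simp [not_not.1 hx, hr, teichmuller_zero]
  simp_rw [h]
  rw [← sum_filter, sum_const, filter_ne', card_erase_of_mem (mem_univ _), nsmul_eq_mul,
    card_univ, Nat.cast_sub Fintype.card_pos, Nat.cast_one]

/-- A Witt vector fixed by Frobenius has its coefficients in the prime field, so it is a `2`-adic
integer; hence it is congruent to a natural number modulo every power of `2`. -/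
lemma exists_nat_of_frobenius_eq {F : Type*} [Field F] [Fintype F] [CharP F 2]
    (N : ℕ) {t : WittVector 2 F} (ht : WittVector.frobenius t = t) :
    ∃ (m : ℕ) (s : WittVector 2 F), t = m + 2 ^ N * s := by
  induction N generalizing t with
  | zero => exact ⟨0, t, by simp⟩
  | succ N ih =>
    have h0 : t.coeff 0 ^ 2 = t.coeff 0 := by
      rw [← coeff_frobenius_charP, ht]
    obtain ⟨c, hc⟩ : ∃ c : ℕ, (c : F) = t.coeff 0 := by
      rcases IsIdempotentElem.iff_eq_zero_or_one.1 ((sq _).symm.trans h0) with h | h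
      · exact ⟨0, by simp [h]⟩
      · exact ⟨1, by simp [h]⟩
    have hcc : (t - (c : WittVector 2 F)).coeff 0 = 0 := by
      change constantCoeff (t - (c : WittVector 2 F)) = 0
      rw [map_sub, map_natCast, hc]
      exact sub_self _
    obtain ⟨s, hs⟩ := Ideal.mem_span_singleton.1 ((mem_span_p_iff_coeff_zero_eq_zero _).2 hcc)
    have h2 : ((2 : ℕ) : WittVector 2 F) ≠ 0 := p_nonzero 2 F
    have hfs : WittVector.frobenius s = s := by
      refine mul_left_cancel₀ h2 ?_
      rw [← hs]
      conv_lhs =>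
        rw [← map_natCast (WittVector.frobenius (p := 2) (R := F)) 2, ← map_mul, ← hs]
      rw [map_sub, ht, map_natCast]
    obtain ⟨m, s', hm⟩ := ih hfs
    refine ⟨c + 2 * m, s', ?_⟩
    rw [eq_add_of_sub_eq hs, hm]
    push_cast
    ring

/-- The `2`-adic valuation of an integer does not change in the Witt vectors. -/
lemma two_pow_dvd_of_intCast_dvd {F : Type*} [Field F] [CharP F 2]
    (N : ℕ) {k : ℤ}
    (h : (2 : WittVector 2 F) ^ N ∣ (k : WittVector 2 F)) :
    (2 : ℤ) ^ N ∣ k := by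
  induction N generalizing k with
  | zero => simp
  | succ N ih =>
    have hk : (k : F) = 0 := by
      obtain ⟨s, hs⟩ := h
      have := congrArg constantCoeff hs
      rw [map_intCast, pow_succ', mul_assoc, map_mul, map_ofNat, CharTwo.two_eq_zero,
        zero_mul] at this
      exact this
    obtain ⟨l, rfl⟩ := (CharP.intCast_eq_zero_iff F 2 k).1 hk
    rw [pow_succ']
    have h2 : (2 : WittVector 2 F) ≠ 0 := by exact_mod_cast p_nonzero 2 F
    refine mul_dvd_mul_left _ (ih ?_)
    rw [pow_succ'] at h
    push_cast at h
    exact (mul_dvd_mul_iff_left h2).1 h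

/-! ### Moments of the lifted traces -/

lemma sum_sum_teichmuller_eq_zero {F ι : Type*} [Field F] [Fintype F] [CharP F 2] (a : F)
    (A : Finset ι) (r s : ι → ℕ) (h : ∀ i ∈ A, ¬ r i ≡ s i [MOD Fintype.card F - 1]) :
    ∑ x : F, ∑ i ∈ A, teichmuller 2 x⁻¹ ^ r i * teichmuller 2 (a * x) ^ s i = 0 := by
  rw [sum_comm]
  exact sum_eq_zero fun i hi => sum_teichmuller_inv_pow_mul_pow a (h i hi)

lemma conjPairSum_eq_sum_sigma {R : Type*} [CommRing R] (n : ℕ) (x : R) :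
    conjPairSum n x = ∑ p ∈ (range n).sigma range, x ^ (2 ^ p.2 + 2 ^ p.1) :=
  (sum_sigma (range n) range fun p => x ^ (2 ^ p.2 + 2 ^ p.1)).symm

lemma sum_conjSum_inv {F : Type*} [Field F] [Fintype F] [CharP F 2]
    {n : ℕ} (hn : 4 ≤ n) (hF : Fintype.card F = 2 ^ n) :
    ∑ x : F, conjSum n (teichmuller 2 x⁻¹) = 0 := by
  rw [← sum_sum_teichmuller_eq_zero (1 : F) (range n) (2 ^ ·) (fun _ => 0)]
  · simp [conjSum]
  · intro i hi
    rw [hF, Nat.modEq_zero_iff_dvd]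
    exact not_dvd_two_pow hn (mem_range.1 hi)

lemma sum_conjSum_mul {F : Type*} [Field F] [Fintype F] [CharP F 2]
    {n : ℕ} (hn : 4 ≤ n) (hF : Fintype.card F = 2 ^ n) (a : F) :
    ∑ x : F, conjSum n (teichmuller 2 (a * x)) = 0 := by
  rw [← sum_sum_teichmuller_eq_zero a (range n) (fun _ => 0) (2 ^ ·)]
  · simp [conjSum]
  · intro i hi
    rw [hF, Nat.ModEq.comm, Nat.modEq_zero_iff_dvd]
    exact not_dvd_two_pow hn (mem_range.1 hi)

lemma sum_conjPairSum_inv {F : Type*} [Field F] [Fintype F] [CharP F 2]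
    {n : ℕ} (hn : 4 ≤ n) (hF : Fintype.card F = 2 ^ n) :
    ∑ x : F, conjPairSum n (teichmuller 2 x⁻¹) = 0 := by
  rw [← sum_sum_teichmuller_eq_zero (1 : F) ((range n).sigma range)
    (fun p => 2 ^ p.2 + 2 ^ p.1) (fun _ => 0)]
  · simp [conjPairSum_eq_sum_sigma]
  · intro p hp
    obtain ⟨hj, hi⟩ : p.1 < n ∧ p.2 < p.1 := by simpa using hp
    rw [hF, Nat.modEq_zero_iff_dvd]
    exact not_dvd_two_pow_add hn (hi.trans hj) hj

lemma sum_conjPairSum_mul {F : Type*} [Field F] [Fintype F] [CharP F 2]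
    {n : ℕ} (hn : 4 ≤ n) (hF : Fintype.card F = 2 ^ n) (a : F) :
    ∑ x : F, conjPairSum n (teichmuller 2 (a * x)) = 0 := by
  rw [← sum_sum_teichmuller_eq_zero a ((range n).sigma range)
    (fun _ => 0) (fun p => 2 ^ p.2 + 2 ^ p.1)]
  · simp [conjPairSum_eq_sum_sigma]
  · intro p hp
    obtain ⟨hj, hi⟩ : p.1 < n ∧ p.2 < p.1 := by simpa using hp
    rw [hF, Nat.ModEq.comm, Nat.modEq_zero_iff_dvd]
    exact not_dvd_two_pow_add hn (hi.trans hj) hj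

lemma sum_conjPairSum_inv_mul_conjSum_inv {F : Type*} [Field F] [Fintype F] [CharP F 2]
    {n : ℕ} (hn : 4 ≤ n) (hF : Fintype.card F = 2 ^ n) :
    ∑ x : F, conjPairSum n (teichmuller 2 x⁻¹) * conjSum n (teichmuller 2 x⁻¹) = 0 := by
  rw [← sum_sum_teichmuller_eq_zero (1 : F) ((range n).sigma range ×ˢ range n)
    (fun p => 2 ^ p.1.2 + 2 ^ p.1.1 + 2 ^ p.2) (fun _ => 0)]
  · refine sum_congr rfl fun x _ => ?_
    simp only [conjPairSum_eq_sum_sigma, conjSum, sum_mul_sum, sum_product, pow_add, pow_zero,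
      mul_one]
  · intro p hp
    obtain ⟨⟨hj, hi⟩, hk⟩ : (p.1.1 < n ∧ p.1.2 < p.1.1) ∧ p.2 < n := by simpa using hp
    rw [hF, Nat.modEq_zero_iff_dvd]
    exact not_dvd_two_pow_add_add hn (hi.trans hj) hj hk

lemma sum_conjPairSum_mul_mul_conjSum_mul {F : Type*} [Field F] [Fintype F] [CharP F 2]
    {n : ℕ} (hn : 4 ≤ n) (hF : Fintype.card F = 2 ^ n) (a : F) :
    ∑ x : F, conjPairSum n (teichmuller 2 (a * x)) * conjSum n (teichmuller 2 (a * x)) = 0 := by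
  rw [← sum_sum_teichmuller_eq_zero a ((range n).sigma range ×ˢ range n)
    (fun _ => 0) (fun p => 2 ^ p.1.2 + 2 ^ p.1.1 + 2 ^ p.2)]
  · refine sum_congr rfl fun x _ => ?_
    simp only [conjPairSum_eq_sum_sigma, conjSum, sum_mul_sum, sum_product, pow_add, pow_zero,
      one_mul]
  · intro p hp
    obtain ⟨⟨hj, hi⟩, hk⟩ : (p.1.1 < n ∧ p.1.2 < p.1.1) ∧ p.2 < n := by simpa using hp
    rw [hF, Nat.ModEq.comm, Nat.modEq_zero_iff_dvd]
    exact not_dvd_two_pow_add_add hn (hi.trans hj) hj hk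

lemma sum_conjPairSum_inv_mul_conjSum_mul {F : Type*} [Field F] [Fintype F] [CharP F 2]
    {n : ℕ} (hn : 4 ≤ n) (hF : Fintype.card F = 2 ^ n) (a : F) :
    ∑ x : F, conjPairSum n (teichmuller 2 x⁻¹) * conjSum n (teichmuller 2 (a * x)) = 0 := by
  rw [← sum_sum_teichmuller_eq_zero a ((range n).sigma range ×ˢ range n)
    (fun p => 2 ^ p.1.2 + 2 ^ p.1.1) (fun p => 2 ^ p.2)]
  · refine sum_congr rfl fun x _ => ?_
    simp only [conjPairSum_eq_sum_sigma, conjSum, sum_mul_sum, sum_product]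
  · intro p hp
    obtain ⟨⟨hj, hi⟩, hk⟩ : (p.1.1 < n ∧ p.1.2 < p.1.1) ∧ p.2 < n := by simpa using hp
    rw [hF]
    exact two_pow_add_not_modEq hn hi hj hk

lemma sum_conjSum_inv_mul_conjPairSum_mul {F : Type*} [Field F] [Fintype F] [CharP F 2]
    {n : ℕ} (hn : 4 ≤ n) (hF : Fintype.card F = 2 ^ n) (a : F) :
    ∑ x : F, conjSum n (teichmuller 2 x⁻¹) * conjPairSum n (teichmuller 2 (a * x)) = 0 := by
  rw [← sum_sum_teichmuller_eq_zero a (range n ×ˢ (range n).sigma range)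
    (fun p => 2 ^ p.1) (fun p => 2 ^ p.2.2 + 2 ^ p.2.1)]
  · refine sum_congr rfl fun x _ => ?_
    simp only [conjPairSum_eq_sum_sigma, conjSum, sum_mul_sum, sum_product]
  · intro p hp
    obtain ⟨hk, hj, hi⟩ : p.1 < n ∧ p.2.1 < n ∧ p.2.2 < p.2.1 := by simpa using hp
    rw [hF, Nat.ModEq.comm]
    exact two_pow_add_not_modEq hn hi hj hk

/-- The only nonvanishing moment: exactly the diagonal terms of the product survive. -/
lemma sum_conjSum_inv_mul_conjSum_mul {F : Type*} [Field F] [Fintype F] [CharP F 2]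
    {n : ℕ} (hn : 4 ≤ n) (hF : Fintype.card F = 2 ^ n) (a : F) :
    ∑ x : F, conjSum n (teichmuller 2 x⁻¹) * conjSum n (teichmuller 2 (a * x)) =
      ((Fintype.card F : WittVector 2 F) - 1) * conjSum n (teichmuller 2 a) := by
  simp only [conjSum, sum_mul_sum]
  rw [sum_comm, mul_sum]
  refine sum_congr rfl fun i hi => ?_
  rw [sum_comm, sum_eq_single_of_mem i hi]
  · exact sum_teichmuller_inv_pow_mul_pow_self a (by positivity)
  · intro j hj hji
    refine sum_teichmuller_inv_pow_mul_pow a ?_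
    rw [hF, two_pow_modEq_iff hn (mem_range.1 hi) (mem_range.1 hj)]
    exact hji.symm

lemma teichmuller_pow_two_pow {F : Type*} [Field F] [Fintype F] {n : ℕ}
    (hF : Fintype.card F = 2 ^ n) (y : F) : teichmuller 2 y ^ 2 ^ n = teichmuller 2 y := by
  rw [← map_pow, ← hF, FiniteField.pow_card]

lemma frobenius_conjSum_teichmuller {F : Type*} [Field F] [Fintype F] [CharP F 2] {n : ℕ}
    (hF : Fintype.card F = 2 ^ n) (y : F) :
    WittVector.frobenius (conjSum n (teichmuller 2 y)) = conjSum n (teichmuller 2 y) := by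
  rw [map_conjSum, frobenius_eq_map_frobenius, map_teichmuller, frobenius_def, map_pow,
    conjSum_pow_two (teichmuller_pow_two_pow hF y)]

/-- The sum over `x` of the cubic polynomial in `τ(x⁻¹) + τ(a x)` that represents `3 (-1) ^ t`
modulo `16`. -/
lemma sum_cubic_conjSum {F : Type*} [Field F] [Fintype F] [CharP F 2]
    {n : ℕ} (hn : 4 ≤ n) (hF : Fintype.card F = 2 ^ n) (a : F) :
    ∑ x : F, (3 - 20 * (conjSum n (teichmuller 2 x⁻¹) + conjSum n (teichmuller 2 (a * x)))
      + 18 * (conjSum n (teichmuller 2 x⁻¹) + conjSum n (teichmuller 2 (a * x))) ^ 2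
      - 4 * (conjSum n (teichmuller 2 x⁻¹) + conjSum n (teichmuller 2 (a * x))) ^ 3) =
    3 * (Fintype.card F : WittVector 2 F) +
      12 * (((Fintype.card F : WittVector 2 F) - 1) * conjSum n (teichmuller 2 a)) := by
  have h (x : F) := conjSum_sq (teichmuller_pow_two_pow hF x)
  -- Lower the degree of each variable to one by the squaring identity, at the cost of pair sums.
  have key (u v w z : WittVector 2 F) (hu : u ^ 2 = u + 2 * w) (hv : v ^ 2 = v + 2 * z) :
      3 - 20 * (u + v) + 18 * (u + v) ^ 2 - 4 * (u + v) ^ 3 =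
        3 - 6 * u - 6 * v + 12 * (u * v) + 28 * w + 28 * z - 8 * (w * u) - 8 * (z * v)
          - 24 * (w * v) - 24 * (u * z) := by
    linear_combination (18 - 4 * u - 4 - 12 * v) * hu + (18 - 4 * v - 4 - 12 * u) * hv
  simp_rw [fun x => key _ _ _ _ (h x⁻¹) (h (a * x))]
  simp only [sum_add_distrib, sum_sub_distrib, ← mul_sum, sum_conjSum_inv hn hF,
    sum_conjSum_mul hn hF, sum_conjPairSum_inv hn hF, sum_conjPairSum_mul hn hF,
    sum_conjPairSum_inv_mul_conjSum_inv hn hF, sum_conjPairSum_mul_mul_conjSum_mul hn hF,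
    sum_conjPairSum_inv_mul_conjSum_mul hn hF, sum_conjSum_inv_mul_conjPairSum_mul hn hF,
    sum_conjSum_inv_mul_conjSum_mul hn hF, sum_const, card_univ, nsmul_eq_mul]
  ring

/-! ### The Kloosterman sum modulo 16 -/

/-- Three times the binomial expansion of `(1 - 2) ^ m` through its cubic term; the later terms are
multiples of `16`. -/
lemma three_mul_neg_one_pow_modEq (m : ℕ) :
    (16 : ℤ) ∣ 3 * (-1) ^ m - (3 - 20 * m + 18 * m ^ 2 - 4 * m ^ 3) := by
  obtain ⟨k, rfl | rfl⟩ := Nat.even_or_odd' m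
  · obtain ⟨c, hc⟩ := Int.even_mul_succ_self (k : ℤ)
    refine ⟨2 * k ^ 3 - 5 * k ^ 2 + 2 * k + c, ?_⟩
    rw [pow_mul]
    push_cast
    norm_num
    linear_combination 8 * hc
  · obtain ⟨c, hc⟩ := Int.even_mul_succ_self (k : ℤ)
    refine ⟨2 * k ^ 3 - k ^ 2 - c, ?_⟩
    rw [pow_succ, pow_mul]
    push_cast
    norm_num
    linear_combination (-8) * hc

/-- With `0⁻¹ = 0`, the power `x ^ (q - 2)` is inversion on the whole field once `q > 2`. -/
lemma pow_card_sub_two {F : Type*} [Field F] [Fintype F] (h : 2 < Fintype.card F) (x : F) :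
    x ^ (Fintype.card F - 2) = x⁻¹ := by
  rcases eq_or_ne x 0 with rfl | hx
  · rw [zero_pow (by omega), inv_zero]
  · refine eq_inv_of_mul_eq_one_left ?_
    rw [← pow_succ, show Fintype.card F - 2 + 1 = Fintype.card F - 1 by omega,
      FiniteField.pow_card_sub_one_eq_one x hx]

lemma algebraMap_trace_eq_conjSum {F : Type*} [Field F] [Fintype F] [Algebra (ZMod 2) F] {n : ℕ}
    (hF : Fintype.card F = 2 ^ n) (y : F) :
    algebraMap (ZMod 2) F (Algebra.trace (ZMod 2) F y) = conjSum n y := by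
  have h := Module.card_eq_pow_finrank (K := ZMod 2) (V := F)
  rw [hF, ZMod.card] at h
  rw [FiniteField.algebraMap_trace_eq_sum_pow, ← Nat.pow_right_injective le_rfl h, Nat.card_zmod,
    conjSum]

lemma trace_eq_natCast {F : Type*} [Field F] [Fintype F] [Algebra (ZMod 2) F] {n m : ℕ}
    (hF : Fintype.card F = 2 ^ n) {y : F} (h : conjSum n y = m) :
    Algebra.trace (ZMod 2) F y = m := by
  apply (algebraMap (ZMod 2) F).injective
  rw [algebraMap_trace_eq_conjSum hF, h, map_natCast]

lemma constantCoeff_teichmuller {F : Type*} [Field F] (y : F) :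
    constantCoeff (teichmuller 2 y) = y :=
  teichmuller_coeff_zero 2 y

lemma natCast_eq_constantCoeff {F : Type*} [Field F] [CharP F 2] {m N : ℕ} (hN : N ≠ 0)
    {t s : WittVector 2 F} (h : t = m + 2 ^ N * s) : constantCoeff t = m := by
  have h2 : constantCoeff (2 : WittVector 2 F) = 0 :=
    (map_ofNat constantCoeff 2).trans CharTwo.two_eq_zero
  rw [h, map_add, map_mul, map_pow, h2, zero_pow hN, zero_mul, add_zero, map_natCast]

/-- Since `τ(y) + τ(z)` is a `2`-adic integer lifting `Tr (y + z)`, its parity is the exponent of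
the sign. -/
lemma dvd_three_mul_sign_sub {F : Type*} [Field F] [Fintype F] [Algebra (ZMod 2) F] [CharP F 2]
    {n : ℕ} (hF : Fintype.card F = 2 ^ n) (y z : F) :
    (2 : WittVector 2 F) ^ 4 ∣
      3 * (((-1) ^ (Algebra.trace (ZMod 2) F (y + z)).val : ℤ) : WittVector 2 F) -
      (3 - 20 * (conjSum n (teichmuller 2 y) + conjSum n (teichmuller 2 z))
        + 18 * (conjSum n (teichmuller 2 y) + conjSum n (teichmuller 2 z)) ^ 2
        - 4 * (conjSum n (teichmuller 2 y) + conjSum n (teichmuller 2 z)) ^ 3) := by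
  set t := conjSum n (teichmuller 2 y) + conjSum n (teichmuller 2 z) with htdef
  obtain ⟨m, s, ht⟩ := exists_nat_of_frobenius_eq 4 (t := t) (by
    rw [htdef, map_add, frobenius_conjSum_teichmuller hF, frobenius_conjSum_teichmuller hF])
  have htr : Algebra.trace (ZMod 2) F (y + z) = m := by
    have hm := natCast_eq_constantCoeff (by norm_num) ht
    rw [htdef, map_add, map_conjSum, map_conjSum, constantCoeff_teichmuller,
      constantCoeff_teichmuller, ← algebraMap_trace_eq_conjSum hF,
      ← algebraMap_trace_eq_conjSum hF, ← map_add, ← map_add, algebraMap_trace_eq_conjSum hF] at hm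
    exact trace_eq_natCast hF hm
  rw [htr, ZMod.val_natCast, ← neg_one_pow_eq_pow_mod_two]
  obtain ⟨c, hc⟩ := three_mul_neg_one_pow_modEq m
  have hc' := congrArg (Int.cast : ℤ → WittVector 2 F) hc
  push_cast at hc' ⊢
  refine ⟨c + 20 * s - 18 * s * (t + m) + 4 * s * (t ^ 2 + t * m + m ^ 2), ?_⟩
  linear_combination hc' + (20 - 18 * (t + m) + 4 * (t ^ 2 + t * m + m ^ 2)) * ht

/-- The congruence behind the theorem: modulo `16` the Kloosterman sum is `-4` times the lifted
trace of `a`. -/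
lemma dvd_binaryKloosterman_add {F : Type*} [Field F] [Fintype F] [Algebra (ZMod 2) F] [CharP F 2]
    {n : ℕ} (hn : 4 ≤ n) (hF : Fintype.card F = 2 ^ n) (a : F) {m : ℕ} {s : WittVector 2 F}
    (hm : conjSum n (teichmuller 2 a) = m + 2 ^ 4 * s) :
    (16 : ℤ) ∣ binaryKloosterman F a + 4 * m := by
  have hq : 2 ^ 4 ∣ Fintype.card F := hF ▸ pow_dvd_pow 2 hn
  have hlt : 2 < Fintype.card F := by
    have := Nat.le_of_dvd Fintype.card_pos hq
    omega
  have hsum := dvd_sum fun (x : F) (_ : x ∈ univ) => dvd_three_mul_sign_sub hF x⁻¹ (a * x)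
  rw [sum_sub_distrib, sum_cubic_conjSum hn hF a, ← mul_sum, ← Int.cast_sum] at hsum
  have hK : ∑ x : F, (-1 : ℤ) ^ (Algebra.trace (ZMod 2) F (x⁻¹ + a * x)).val =
      binaryKloosterman F a := by
    simp only [binaryKloosterman, pow_card_sub_two hlt]
  rw [hK, hm] at hsum
  obtain ⟨c, hc⟩ := hq
  have hW : (2 : WittVector 2 F) ^ 4 ∣
      ((3 * (binaryKloosterman F a + 4 * m) : ℤ) : WittVector 2 F) := by
    obtain ⟨d, hd⟩ := hsum
    rw [hc] at hd
    push_cast at hd ⊢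
    refine ⟨d + 3 * c + 12 * c * (m + 2 ^ 4 * s) - 12 * s, ?_⟩
    linear_combination hd
  have := two_pow_dvd_of_intCast_dvd 4 hW
  omega

lemma mul_self_eq_add_two_mul_choose_two (m : ℕ) : m * m = m + 2 * m.choose 2 := by
  induction m with
  | zero => rfl
  | succ m ih =>
    rw [Nat.choose_succ_succ' m 1, Nat.choose_one_right]
    linarith

lemma choose_two_mod_two (m : ℕ) : m.choose 2 % 2 = m % 4 / 2 := by
  induction m with
  | zero => rfl
  | succ m ih =>
    rw [Nat.choose_succ_succ' m 1, Nat.choose_one_right, one_add_one_eq_two]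
    have h : m % 4 = 0 ∨ m % 4 = 1 ∨ m % 4 = 2 ∨ m % 4 = 3 := by omega
    rcases h with h | h | h | h <;> omega

/-- The lifted trace of `a` modulo `4` determines `Q(a)`, by the identity `t ^ 2 = t + 2 Q` in the
Witt vectors. -/
lemma quadraticTrace_eq_choose_two {F : Type*} [Field F] [Fintype F] [CharP F 2]
    {n : ℕ} (hF : Fintype.card F = 2 ^ n) (a : F) {m : ℕ} {s : WittVector 2 F}
    (hm : conjSum n (teichmuller 2 a) = m + 2 ^ 4 * s) :
    quadraticTrace n a = (m.choose 2 : ℕ) := by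
  have h2 : (2 : WittVector 2 F) ≠ 0 := by exact_mod_cast p_nonzero 2 F
  have hch : (m : WittVector 2 F) * m = m + 2 * (m.choose 2 : ℕ) := by
    have h := congrArg (Nat.cast : ℕ → WittVector 2 F) (mul_self_eq_add_two_mul_choose_two m)
    push_cast at h
    exact h
  have hQ : conjPairSum n (teichmuller 2 a) =
      ((m.choose 2 : ℕ) : WittVector 2 F) + 2 ^ 1 * (4 * s * (2 * m + 2 ^ 4 * s - 1)) := by
    apply mul_left_cancel₀ h2
    have hsq := conjSum_sq (teichmuller_pow_two_pow hF a)
    rw [hm] at hsq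
    linear_combination hch - hsq
  have := natCast_eq_constantCoeff one_ne_zero hQ
  rwa [map_conjPairSum, constantCoeff_teichmuller] at this

theorem theorem1p2 {F : Type*} [Field F] [Fintype F] [Algebra (ZMod 2) F]
    (n : ℕ) (hn : 4 ≤ n) (hF : Fintype.card F = 2 ^ n) (a : F) :
    (quadraticTrace n a = 0 ∨ quadraticTrace n a = 1) ∧
    (Algebra.trace (ZMod 2) F a = 0 → quadraticTrace n a = 0 →
      binaryKloosterman F a ≡ 0 [ZMOD 16]) ∧
    (Algebra.trace (ZMod 2) F a = 1 → quadraticTrace n a = 1 →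
      binaryKloosterman F a ≡ 4 [ZMOD 16]) ∧
    (Algebra.trace (ZMod 2) F a = 0 → quadraticTrace n a = 1 →
      binaryKloosterman F a ≡ 8 [ZMOD 16]) ∧
    (Algebra.trace (ZMod 2) F a = 1 → quadraticTrace n a = 0 →
      binaryKloosterman F a ≡ 12 [ZMOD 16]) := by
  have : CharP F 2 := charP_of_injective_algebraMap (algebraMap (ZMod 2) F).injective 2
  obtain ⟨m, s, hm⟩ := exists_nat_of_frobenius_eq 4 (frobenius_conjSum_teichmuller hF a)
  have hK := dvd_binaryKloosterman_add hn hF a hm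
  have hQ := quadraticTrace_eq_choose_two hF a hm
  have hT : Algebra.trace (ZMod 2) F a = m := by
    have := natCast_eq_constantCoeff (by norm_num) hm
    rw [map_conjSum, constantCoeff_teichmuller] at this
    exact trace_eq_natCast hF this
  have hQ0 : quadraticTrace n a = 0 ↔ m.choose 2 % 2 = 0 := by
    rw [hQ, CharP.cast_eq_zero_iff F 2, Nat.dvd_iff_mod_eq_zero]
  have hQ1 : quadraticTrace n a = 1 ↔ m.choose 2 % 2 = 1 := by
    rw [hQ, ← Nat.cast_one, CharP.natCast_eq_natCast F 2, Nat.ModEq]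
  have hT0 : Algebra.trace (ZMod 2) F a = 0 ↔ m % 2 = 0 := by
    rw [hT, CharP.cast_eq_zero_iff (ZMod 2) 2, Nat.dvd_iff_mod_eq_zero]
  have hT1 : Algebra.trace (ZMod 2) F a = 1 ↔ m % 2 = 1 := by
    rw [hT, ← Nat.cast_one, CharP.natCast_eq_natCast (ZMod 2) 2, Nat.ModEq]
  rw [hQ0, hQ1, hT0, hT1, choose_two_mod_two]
  simp only [Int.ModEq]
  omega
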